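/- Work in the ring $\mathbb{Z}[[q]]$ of formal power series, with infinite sums and products taken coefficientwise. Let $(q;q)_n=\prod_{j=1}^{n}(1-q^j)$, $(q;q)_\infty=\prod_{j=1}^{\infty}(1-q^j)$, and define $$f(a,b)=\sum_{i=0}^{\infty}a^{i(i+1)/2}b^{i(i-1)/2}+\sum_{i=1}^{\infty}a^{i(i-1)/2}b^{i(i+1)/2},\qquad \Psi(a,b)=\sum_{i=0}^{\infty}a^{i(i+1)/2}b^{i(i-1)/2}-\sum_{i=1}^{\infty}a^{i(i-1)/2}b^{i(i+1)/2}.$$ For $k\ge 1$ and $l_1,\dots,l_{k-1}\ge 0$ write $i_j=\sum_{s=j}^{k-1}l_s$. Then all the series and products below converge in $\mathbb{Z}[[q]]$, and: (1) For every $k\ge 2$, $$\Psi(q^{2k-1},q)=\sum_{i=0}^{\infty}q^{ki^2+(k-1)i}-\sum_{i=1}^{\infty}q^{k(i^2-i)+i}=(q;q)_\infty\sum_{l_1,\dots,l_{k-1}\ge 0}\frac{q^{\sum_{j=1}^{k-1}i_j(i_j+1)}}{(q;q)_{l_{k-1}}^2\prod_{j=1}^{k-2}(q;q)_{l_j}}.$$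 (2) (Andrews--Gordon identity for the theta function) For every $k\ge 1$, $$f(-q^{2k},-q)=\sum_{i=0}^{\infty}(-1)^iq^{k(i^2+i)}q^{i(i-1)/2}+\sum_{i=1}^{\infty}(-1)^iq^{k(i^2-i)}q^{i(i+1)/2}=(q;q)_\infty\sum_{l_1,\dots,l_{k-1}\ge 0}\frac{q^{\sum_{j=1}^{k-1}i_j(i_j+1)}}{\prod_{j=1}^{k-1}(q;q)_{l_j}},$$ where for $k=1$ the sum on the right has the single term $1$. -/

import Mathlib

/-!
All series live in the ring `ℤ⟦X⟧` of formal power series, the indeterminate `X` playing the role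
of `q`. Infinite sums and products are taken in the topology of coefficientwise convergence
(`ℤ` being discrete).
-/

open PowerSeries
open scoped PowerSeries.WithPiTopology

namespace QSeries

/-- The `q`-Pochhammer symbol `(a; q)_n = ∏_{j=0}^{n-1} (1 - a q^j)`. -/
noncomputable def qPochhammer (a q : ℤ⟦X⟧) (n : ℕ) : ℤ⟦X⟧ :=
  ∏ j ∈ Finset.range n, (1 - a * q ^ j)

/-- The infinite `q`-Pochhammer symbol `(a; q)_∞ = ∏_{j=0}^∞ (1 - a q^j)`. -/
noncomputable def qPochhammerInf (a q : ℤ⟦X⟧) : ℤ⟦X⟧ :=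
  ∏' j : ℕ, (1 - a * q ^ j)

/-- The two variable Ramanujan theta function
`f(a, b) = ∑_{i ≥ 0} a^{i(i+1)/2} b^{i(i-1)/2} + ∑_{i ≥ 1} a^{i(i-1)/2} b^{i(i+1)/2}`. -/
noncomputable def ramanujanTheta (a b : ℤ⟦X⟧) : ℤ⟦X⟧ :=
  (∑' i : ℕ, a ^ (i * (i + 1) / 2) * b ^ (i * (i - 1) / 2)) +
    ∑' i : ℕ+, a ^ ((i : ℕ) * ((i : ℕ) - 1) / 2) * b ^ ((i : ℕ) * ((i : ℕ) + 1) / 2)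

/-- The two variable Ramanujan false theta function
`Ψ(a, b) = ∑_{i ≥ 0} a^{i(i+1)/2} b^{i(i-1)/2} - ∑_{i ≥ 1} a^{i(i-1)/2} b^{i(i+1)/2}`. -/
noncomputable def falseTheta (a b : ℤ⟦X⟧) : ℤ⟦X⟧ :=
  (∑' i : ℕ, a ^ (i * (i + 1) / 2) * b ^ (i * (i - 1) / 2)) -
    ∑' i : ℕ+, a ^ ((i : ℕ) * ((i : ℕ) - 1) / 2) * b ^ ((i : ℕ) * ((i : ℕ) + 1) / 2)

/-- The multiplicative inverse of a formal power series with constant coefficient `1`. -/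
noncomputable def recip (φ : ℤ⟦X⟧) : ℤ⟦X⟧ := PowerSeries.invOfUnit φ 1

theorem mul_recip (φ : ℤ⟦X⟧) (h : constantCoeff φ = 1) : φ * recip φ = 1 :=
  PowerSeries.mul_invOfUnit φ 1 (by simpa using h)

theorem constantCoeff_qPochhammer (n : ℕ) :
    constantCoeff (qPochhammer (X : ℤ⟦X⟧) X n) = 1 := by
  simp [qPochhammer, map_prod]

/-- The tail sum `i_j = ∑_{s ≥ j} l_s` of a finite tuple of natural numbers. -/
def tailSum {m : ℕ} (l : Fin m → ℕ) (j : Fin m) : ℕ := ∑ s ∈ Finset.Ici j, l s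

/-- The exponent `∑_j i_j (i_j + 1)`, where `i_j = ∑_{s ≥ j} l_s`. -/
def tailExponent {m : ℕ} (l : Fin m → ℕ) : ℕ := ∑ j, tailSum l j * (tailSum l j + 1)

/-- `(q; q)_{l_1} ⋯ (q; q)_{l_{k-1}}`. The tuple `(l_1, …, l_{k-1})` is indexed by `Fin (k - 1)`, so
that `l_j` is the value at index `j - 1`. -/
noncomputable def thetaDenom (k : ℕ) (l : Fin (k - 1) → ℕ) : ℤ⟦X⟧ :=
  ∏ j, qPochhammer X X (l j)

/-- `(q; q)_{l_{k-1}}^2 (q; q)_{l_1} ⋯ (q; q)_{l_{k-2}}`, for `k ≥ 2`, with the same indexing. -/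
noncomputable def falseThetaDenom (k : ℕ) (hk : 2 ≤ k) (l : Fin (k - 1) → ℕ) : ℤ⟦X⟧ :=
  qPochhammer X X (l ⟨k - 2, by omega⟩) ^ 2 *
    ∏ j : Fin (k - 2), qPochhammer X X (l ⟨j, by omega⟩)

theorem thetaDenom_mul_recip (k : ℕ) (l : Fin (k - 1) → ℕ) :
    thetaDenom k l * recip (thetaDenom k l) = 1 :=
  mul_recip _ (by simp [thetaDenom, map_prod, constantCoeff_qPochhammer])

theorem falseThetaDenom_mul_recip (k : ℕ) (hk : 2 ≤ k) (l : Fin (k - 1) → ℕ) :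
    falseThetaDenom k hk l * recip (falseThetaDenom k hk l) = 1 :=
  mul_recip _ (by simp [falseThetaDenom, map_prod, constantCoeff_qPochhammer])

/-- The general term of the multisum for the theta function. -/
noncomputable def thetaTerm (k : ℕ) (l : Fin (k - 1) → ℕ) : ℤ⟦X⟧ :=
  X ^ tailExponent l * recip (thetaDenom k l)

/-- The general term of the multisum for the false theta function. -/
noncomputable def falseThetaTerm (k : ℕ) (hk : 2 ≤ k) (l : Fin (k - 1) → ℕ) : ℤ⟦X⟧ :=
  X ^ tailExponent l * recip (falseThetaDenom k hk l)

end QSeries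

open Finset (range)
open Finset.HasAntidiagonal (antidiagonal)

namespace QSeries

/-! The engine is the Bailey chain at $a=q$. For a pair with $\beta_n=\sum_r
A_r/((q)_{n-r}(q)_{n+r+1})$, q-Chu–Vandermonde (`sum_antidiagonal_recipPoch`) shows that applying
`baileyStep` to $\beta$ multiplies $A_r$ by $q^{r(r+1)}$ (`IsBaileyPair.step`). Letting $n\to\infty$
gives $(q)_\infty\sum_s q^{s(s+1)}\beta_s=\sum_r q^{r(r+1)}A_r$; applied after $m$ steps, this
unfolds the left side into a multisum and raises the exponent to $(m+1)r(r+1)$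
(`IsBaileyPair.tsum_eq`).

Two seeds suffice: $A_r=q^{r^2}(1-q^{2r+1})$, $\beta_n=1/(q)_n^2$ for the false theta function, and
the unit pair, whose first step has $\beta_n=1/(q)_n$, for the theta function. Limits are handled as
congruences modulo every $X^N$. -/

/-! ### Reciprocals and q-Chu–Vandermonde -/

theorem recip_unique {φ ψ : ℤ⟦X⟧} (h : constantCoeff φ = 1) (hψ : φ * ψ = 1) : recip φ = ψ := by
  linear_combination ψ * mul_recip φ h - recip φ * hψ

theorem recip_mul {φ ψ : ℤ⟦X⟧} (hφ : constantCoeff φ = 1) (hψ : constantCoeff ψ = 1) :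
    recip (φ * ψ) = recip φ * recip ψ := by
  refine recip_unique (by simp [hφ, hψ]) ?_
  linear_combination ψ * recip ψ * mul_recip φ hφ + mul_recip ψ hψ

theorem recip_prod {ι : Type*} (s : Finset ι) (φ : ι → ℤ⟦X⟧)
    (h : ∀ i, constantCoeff (φ i) = 1) : recip (∏ i ∈ s, φ i) = ∏ i ∈ s, recip (φ i) := by
  refine recip_unique (by simp [map_prod, h]) ?_
  rw [← Finset.prod_mul_distrib]
  exact Finset.prod_eq_one fun i _ => mul_recip _ (h i)

/-- The reciprocal `1 / (q; q)_n`. -/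
noncomputable def recipPoch (n : ℕ) : ℤ⟦X⟧ := recip (qPochhammer X X n)

theorem qPochhammer_mul_recipPoch (n : ℕ) : qPochhammer X X n * recipPoch n = 1 :=
  mul_recip _ (constantCoeff_qPochhammer n)

theorem recipPoch_zero : recipPoch 0 = 1 :=
  recip_unique (constantCoeff_qPochhammer 0) (by simp [qPochhammer])

theorem recipPoch_succ (n : ℕ) : recipPoch n = (1 - X ^ (n + 1)) * recipPoch (n + 1) := by
  refine recip_unique (constantCoeff_qPochhammer n) ?_
  have h := qPochhammer_mul_recipPoch (n + 1)
  rw [qPochhammer, Finset.prod_range_succ, ← qPochhammer] at h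
  linear_combination h

theorem one_sub_X_pow_ne_zero {n : ℕ} (hn : n ≠ 0) : (1 - X ^ n : ℤ⟦X⟧) ≠ 0 := by
  intro h
  have := congrArg constantCoeff h
  simp [hn] at this

/-- A form of the `q`-Chu–Vandermonde summation. -/
theorem sum_antidiagonal_recipPoch (m c : ℕ) :
    ∑ p ∈ antidiagonal m,
        X ^ (p.1 * (p.1 + c)) * recipPoch p.1 * recipPoch p.2 * recipPoch (p.1 + c) =
      recipPoch m * recipPoch (m + c) := by
  induction m generalizing c with
  | zero => simp [recipPoch_zero]
  | succ m ih =>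
    have key : (1 - X ^ (m + 1)) * ∑ p ∈ antidiagonal (m + 1),
          X ^ (p.1 * (p.1 + c)) * recipPoch p.1 * recipPoch p.2 * recipPoch (p.1 + c) =
        ∑ p ∈ antidiagonal m, X ^ (p.1 * (p.1 + (c + 1))) * recipPoch p.1 * recipPoch p.2 *
          recipPoch (p.1 + (c + 1)) := by
      -- Uses $1-q^{i+j}=(1-q^i)+q^i(1-q^j)$. Each half loses a boundary term; after shifting, the
      -- two recombine into the sum for $m$ and $c+1$.
      have h : ∀ p ∈ antidiagonal (m + 1), (1 - X ^ (m + 1)) *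
            (X ^ (p.1 * (p.1 + c)) * recipPoch p.1 * recipPoch p.2 * recipPoch (p.1 + c)) =
          (1 - X ^ p.1) *
            (X ^ (p.1 * (p.1 + c)) * recipPoch p.1 * recipPoch p.2 * recipPoch (p.1 + c)) +
          (1 - X ^ p.2) * (X ^ (p.1 * (p.1 + c) + p.1) * recipPoch p.1 * recipPoch p.2 *
            recipPoch (p.1 + c)) := by
        intro p hp
        rw [← Finset.HasAntidiagonal.mem_antidiagonal.mp hp]
        ring
      rw [Finset.mul_sum, Finset.sum_congr rfl h, Finset.sum_add_distrib,
        Finset.Nat.sum_antidiagonal_succ, Finset.Nat.sum_antidiagonal_succ']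
      simp only [pow_zero, sub_self, zero_mul, zero_add]
      rw [← Finset.sum_add_distrib]
      refine Finset.sum_congr rfl fun p _ => ?_
      rw [show p.1 + 1 + c = p.1 + c + 1 by ring, ← add_assoc, recipPoch_succ p.1,
        recipPoch_succ p.2, recipPoch_succ (p.1 + c)]
      ring
    rw [ih] at key
    refine mul_left_cancel₀ (one_sub_X_pow_ne_zero m.succ_ne_zero) (key.trans ?_)
    rw [recipPoch_succ m, show m + (c + 1) = m + 1 + c by ring, mul_assoc]

/-! ### The Bailey chain -/

/-- `(A, β)` is a Bailey pair relative to `a = q`, with `A = (1 - q) α`. -/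
def IsBaileyPair (A β : ℕ → ℤ⟦X⟧) : Prop :=
  ∀ n, β n = ∑ p ∈ antidiagonal n, A p.1 * recipPoch p.2 * recipPoch (2 * p.1 + p.2 + 1)

/-- One step in the Bailey chain. -/
noncomputable def baileyStep (β : ℕ → ℤ⟦X⟧) (n : ℕ) : ℤ⟦X⟧ :=
  ∑ p ∈ antidiagonal n, X ^ (p.1 * (p.1 + 1)) * β p.1 * recipPoch p.2

theorem sum_antidiagonal_antidiagonal (n : ℕ) (f : ℕ → ℕ → ℕ → ℤ⟦X⟧) :
    ∑ p ∈ antidiagonal n, ∑ r ∈ antidiagonal p.1, f r.1 r.2 p.2 =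
      ∑ p ∈ antidiagonal n, ∑ r ∈ antidiagonal p.2, f p.1 r.1 r.2 := by
  rw [Finset.sum_sigma', Finset.sum_sigma']
  refine Finset.sum_bij' (fun x _ => ⟨(x.2.1, x.2.2 + x.1.2), (x.2.2, x.1.2)⟩)
    (fun x _ => ⟨(x.1.1 + x.2.1, x.2.2), (x.1.1, x.2.1)⟩) ?_ ?_ ?_ ?_ ?_
  · rintro ⟨⟨a, b⟩, ⟨c, d⟩⟩ h
    simp only [Finset.mem_sigma, Finset.HasAntidiagonal.mem_antidiagonal] at h ⊢
    exact ⟨by omega, trivial⟩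
  · rintro ⟨⟨a, b⟩, ⟨c, d⟩⟩ h
    simp only [Finset.mem_sigma, Finset.HasAntidiagonal.mem_antidiagonal] at h ⊢
    exact ⟨by omega, trivial⟩
  · rintro ⟨⟨a, b⟩, ⟨c, d⟩⟩ h
    simp only [Finset.mem_sigma, Finset.HasAntidiagonal.mem_antidiagonal] at h
    obtain ⟨h1, rfl⟩ := h
    rfl
  · rintro ⟨⟨a, b⟩, ⟨c, d⟩⟩ h
    simp only [Finset.mem_sigma, Finset.HasAntidiagonal.mem_antidiagonal] at h
    obtain ⟨h1, rfl⟩ := h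
    rfl
  · rintro ⟨⟨a, b⟩, ⟨c, d⟩⟩ _
    rfl

theorem IsBaileyPair.step {A β : ℕ → ℤ⟦X⟧} (h : IsBaileyPair A β) :
    IsBaileyPair (fun r => X ^ (r * (r + 1)) * A r) (baileyStep β) := by
  intro n
  have h1 : baileyStep β n = ∑ p ∈ antidiagonal n, ∑ r ∈ antidiagonal p.1,
      X ^ ((r.1 + r.2) * (r.1 + r.2 + 1)) *
        (A r.1 * recipPoch r.2 * recipPoch (2 * r.1 + r.2 + 1)) * recipPoch p.2 := by
    refine Finset.sum_congr rfl fun p _ => ?_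
    rw [h, Finset.mul_sum, Finset.sum_mul]
    refine Finset.sum_congr rfl fun r hr => ?_
    rw [Finset.HasAntidiagonal.mem_antidiagonal.mp hr]
  rw [h1, sum_antidiagonal_antidiagonal n fun a b c => X ^ ((a + b) * (a + b + 1)) *
        (A a * recipPoch b * recipPoch (2 * a + b + 1)) * recipPoch c]
  refine Finset.sum_congr rfl fun p _ => ?_
  -- q-Chu–Vandermonde read backwards with $c=2a+1$, since $(a+b)(a+b+1)=a(a+1)+b(b+2a+1)$.
  rw [mul_assoc _ (recipPoch _), show 2 * p.1 + p.2 + 1 = p.2 + (2 * p.1 + 1) by ring,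
    ← sum_antidiagonal_recipPoch, Finset.mul_sum]
  refine Finset.sum_congr rfl fun r _ => ?_
  rw [show 2 * p.1 + r.1 + 1 = r.1 + (2 * p.1 + 1) by ring]
  ring

theorem IsBaileyPair.iterate {A β : ℕ → ℤ⟦X⟧} (h : IsBaileyPair A β) (m : ℕ) :
    IsBaileyPair (fun r => X ^ (m * (r * (r + 1))) * A r) (baileyStep^[m] β) := by
  induction m with
  | zero => simpa using h
  | succ m ih =>
    rw [Function.iterate_succ_apply']
    convert ih.step using 2
    ring

/-! ### The two seed pairs -/

theorem isBaileyPair_falseTheta :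
    IsBaileyPair (fun r => X ^ (r ^ 2) * (1 - X ^ (2 * r + 1))) (fun n => recipPoch n ^ 2) := by
  -- Tails of the defining sum starting at $r=a$ have a closed form; peeling off the first term
  -- passes to $a+1$ with a shorter tail.
  have key : ∀ m a : ℕ, ∑ p ∈ antidiagonal m, X ^ ((a + p.1) ^ 2) *
      (1 - X ^ (2 * (a + p.1) + 1)) * recipPoch p.2 * recipPoch (2 * (a + p.1) + p.2 + 1) =
      X ^ (a ^ 2) * recipPoch m * recipPoch (2 * a + m) := by
    intro m
    induction m with
    | zero =>
      intro a
      simp [recipPoch_zero, recipPoch_succ (2 * a)]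
      ring
    | succ m ih =>
      intro a
      rw [Finset.Nat.sum_antidiagonal_succ]
      have := ih (a + 1)
      simp only [add_assoc, add_comm 1] at this ⊢
      rw [this, recipPoch_succ m, recipPoch_succ (2 * a + (m + 1))]
      simp only [add_zero, mul_add, ← add_assoc, add_right_comm _ m]
      ring
  intro n
  simpa [sq] using (key n 0).symm

/-- The numerators of the unit Bailey pair. -/
noncomputable def unitNumerator (r : ℕ) : ℤ⟦X⟧ :=
  (-1) ^ r * X ^ (r.choose 2) * (1 - X ^ (2 * r + 1))

theorem isBaileyPair_unit : IsBaileyPair unitNumerator (fun n => if n = 0 then 1 else 0) := by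
  -- The same tail induction, with the denominator $1-q^{a+m}$ of the closed form cleared. At $a=0$
  -- the right side vanishes; $n=0$ is separate because the cleared factor is then zero.
  have key : ∀ m a : ℕ, (1 - X ^ (a + m)) * ∑ p ∈ antidiagonal m, unitNumerator (a + p.1) *
      recipPoch p.2 * recipPoch (2 * (a + p.1) + p.2 + 1) =
      (-1) ^ a * X ^ (a.choose 2) * (1 - X ^ a) * recipPoch m * recipPoch (2 * a + m) := by
    intro m
    induction m with
    | zero =>
      intro a
      simp [recipPoch_zero, recipPoch_succ (2 * a), unitNumerator]
      ring
    | succ m ih =>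
      intro a
      rw [Finset.Nat.sum_antidiagonal_succ]
      have := ih (a + 1)
      simp only [add_assoc, add_comm 1] at this ⊢
      rw [mul_add, this, recipPoch_succ m, recipPoch_succ (2 * a + (m + 1)), Nat.choose_succ_succ']
      simp only [unitNumerator, add_zero, mul_add, ← add_assoc, add_right_comm _ m,
        Nat.choose_one_right]
      ring
  intro n
  rcases n with _ | n
  · simpa [recipPoch_zero, unitNumerator] using recipPoch_succ 0
  · have := key (n + 1) 0
    simp only [zero_add, pow_zero, sub_self, mul_zero, zero_mul, mul_eq_zero,
      one_sub_X_pow_ne_zero n.succ_ne_zero, false_or] at this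
    simp [this]

theorem baileyStep_unit : baileyStep (fun n => if n = 0 then 1 else 0) = recipPoch := by
  funext n
  rw [baileyStep, Finset.Nat.sum_antidiagonal_eq_sum_range_succ_mk, Finset.sum_eq_single 0]
  · simp
  · intro b _ hb
    simp [hb]
  · simp

/-! ### Convergence and limits modulo powers of `X` -/

theorem summable_of_X_pow_dvd {ι : Type*} {f : ι → ℤ⟦X⟧} (h : ι → ℕ)
    (hfin : ∀ N, {i | h i ≤ N}.Finite) (hf : ∀ i, X ^ h i ∣ f i) : Summable f := by
  rw [WithPiTopology.summable_iff_summable_coeff]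
  intro d
  refine summable_of_hasFiniteSupport ((hfin d).subset fun i hi => ?_)
  by_contra hd
  exact hi (X_pow_dvd_iff.mp (hf i) d (not_le.mp hd))

theorem X_pow_dvd_tsum_sub_sum {ι : Type*} {f : ι → ℤ⟦X⟧} (hf : Summable f) (s : Finset ι) {N : ℕ}
    (h : ∀ i ∉ s, X ^ N ∣ f i) : X ^ N ∣ ∑' i, f i - ∑ i ∈ s, f i := by
  rw [X_pow_dvd_iff]
  intro m hm
  rw [map_sub, map_sum, sub_eq_zero, hf.map_tsum _ (WithPiTopology.continuous_coeff ℤ m)]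
  exact (hasSum_sum_of_ne_finset_zero fun i hi => X_pow_dvd_iff.mp (h i hi) m hm).tsum_eq

theorem eq_of_forall_X_pow_dvd_sub {φ ψ : ℤ⟦X⟧} (h : ∀ N : ℕ, X ^ N ∣ φ - ψ) : φ = ψ := by
  ext n
  simpa [sub_eq_zero] using X_pow_dvd_iff.mp (h (n + 1)) n n.lt_succ_self

theorem multipliable_one_sub : Multipliable (fun j : ℕ => 1 - (X : ℤ⟦X⟧) * X ^ j) := by
  simpa [pow_succ'] using WithPiTopology.multipliable_one_sub_X_pow ℤ

theorem X_pow_dvd_qPochhammer_sub (N m : ℕ) :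
    (X : ℤ⟦X⟧) ^ (N + 1) ∣ qPochhammer X X (N + m) - qPochhammer X X N := by
  induction m with
  | zero => simp
  | succ m ih =>
    have h : qPochhammer X X (N + (m + 1)) - qPochhammer X X N =
        qPochhammer X X (N + m) - qPochhammer X X N -
          X ^ (N + 1) * (X ^ m * qPochhammer X X (N + m)) := by
      rw [← add_assoc, qPochhammer, Finset.prod_range_succ, ← qPochhammer]
      ring
    rw [h]
    exact dvd_sub ih (dvd_mul_right _ _)

theorem X_pow_dvd_qPochhammerInf_sub (N : ℕ) :
    (X : ℤ⟦X⟧) ^ (N + 1) ∣ qPochhammerInf X X - qPochhammer X X N := by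
  rw [X_pow_dvd_iff]
  intro m hm
  have h := (WithPiTopology.tendsto_iff_coeff_tendsto ℤ _ _ _).mp
    multipliable_one_sub.hasProd.tendsto_prod_nat m
  rw [map_sub, sub_eq_zero]
  refine tendsto_nhds_unique h (tendsto_atTop_of_eventually_const (i₀ := N) fun i hi => ?_)
  obtain ⟨j, rfl⟩ := Nat.exists_eq_add_of_le hi
  simpa [sub_eq_zero, qPochhammer] using X_pow_dvd_iff.mp (X_pow_dvd_qPochhammer_sub N j) m hm

theorem X_pow_dvd_qPochhammerInf_mul_recipPoch_sub_one {N n : ℕ} (h : N ≤ n) :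
    (X : ℤ⟦X⟧) ^ N ∣ qPochhammerInf X X * recipPoch n - 1 := by
  have h1 : qPochhammerInf X X * recipPoch n - 1 =
      (qPochhammerInf X X - qPochhammer X X n) * recipPoch n := by
    linear_combination qPochhammer_mul_recipPoch n
  rw [h1]
  exact ((pow_dvd_pow X (by omega)).trans (X_pow_dvd_qPochhammerInf_sub n)).mul_right _

/-- With total $2N$, one of the two indices is at least $N$: either the term is negligible or it may
be replaced by its limit. -/
theorem X_pow_dvd_sum_antidiagonal_sub (N : ℕ) (F : ℕ × ℕ → ℤ⟦X⟧) (G : ℕ → ℤ⟦X⟧)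
    (hF : ∀ p : ℕ × ℕ, N ≤ p.1 → X ^ N ∣ F p)
    (hG : ∀ p : ℕ × ℕ, N ≤ p.2 → X ^ N ∣ F p - G p.1) :
    X ^ N ∣ ∑ p ∈ antidiagonal (N + N), F p - ∑ s ∈ range N, G s := by
  rw [Finset.Nat.sum_antidiagonal_eq_sum_range_succ_mk, Nat.succ_eq_add_one, add_assoc,
    Finset.sum_range_add, add_sub_right_comm, ← Finset.sum_sub_distrib]
  refine dvd_add (Finset.dvd_sum fun s hs => ?_) (Finset.dvd_sum fun s _ => hF _ (by simp))
  have := Finset.mem_range.mp hs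
  exact hG (s, N + N - s) (by simp; omega)

/-- The limiting case of Bailey's lemma, modulo `X ^ N`. -/
theorem IsBaileyPair.X_pow_dvd {A β : ℕ → ℤ⟦X⟧} (h : IsBaileyPair A β) (N : ℕ) :
    X ^ N ∣ qPochhammerInf X X * ∑ s ∈ range N, X ^ (s * (s + 1)) * β s -
      ∑ r ∈ range N, X ^ (r * (r + 1)) * A r := by
  have hX : ∀ n : ℕ, N ≤ n → (X : ℤ⟦X⟧) ^ N ∣ X ^ (n * (n + 1)) := fun n hn =>
    pow_dvd_pow X (by nlinarith)
  -- `baileyStep β (N + N)` is evaluated twice: by definition, and through the stepped pair, where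
  -- two reciprocals tend to $1/(q)_\infty$ instead of one.
  have h1 : X ^ N ∣ qPochhammerInf X X * baileyStep β (N + N) -
      ∑ s ∈ range N, X ^ (s * (s + 1)) * β s := by
    rw [baileyStep, Finset.mul_sum]
    refine X_pow_dvd_sum_antidiagonal_sub N _ _ (fun p hp => ?_) fun p hp => ?_
    · exact (((hX _ hp).mul_right _).mul_right _).mul_left _
    · convert (X_pow_dvd_qPochhammerInf_mul_recipPoch_sub_one hp).mul_left
        (X ^ (p.1 * (p.1 + 1)) * β p.1) using 1
      ring
  have h2 : X ^ N ∣ qPochhammerInf X X ^ 2 * baileyStep β (N + N) -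
      ∑ r ∈ range N, X ^ (r * (r + 1)) * A r := by
    rw [h.step, Finset.mul_sum]
    refine X_pow_dvd_sum_antidiagonal_sub N _ _ (fun p hp => ?_) fun p hp => ?_
    · exact ((((hX _ hp).mul_right _).mul_right _).mul_right _).mul_left _
    · have ha := X_pow_dvd_qPochhammerInf_mul_recipPoch_sub_one hp
      have hb := X_pow_dvd_qPochhammerInf_mul_recipPoch_sub_one
        (show N ≤ 2 * p.1 + p.2 + 1 by omega)
      convert (dvd_add (ha.mul_right (qPochhammerInf X X * recipPoch (2 * p.1 + p.2 + 1)))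
        hb).mul_left (X ^ (p.1 * (p.1 + 1)) * A p.1) using 1
      ring
  convert dvd_sub h2 (h1.mul_left (qPochhammerInf X X)) using 1
  ring

/-! ### Unfolding the chain into a multisum -/

/-- The general term of the multisum attached to the sequence `β`. -/
noncomputable def chainTerm (β : ℕ → ℤ⟦X⟧) (m : ℕ) (l : Fin (m + 1) → ℕ) : ℤ⟦X⟧ :=
  X ^ tailExponent l * ((∏ j : Fin m, recipPoch (l j.castSucc)) * β (l (Fin.last m)))

theorem tailExponent_cons {m : ℕ} (a : ℕ) (l : Fin m → ℕ) :
    tailExponent (Fin.cons a l : Fin (m + 1) → ℕ) =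
      (a + ∑ i, l i) * (a + ∑ i, l i + 1) + tailExponent l := by
  have h0 : tailSum (Fin.cons a l : Fin (m + 1) → ℕ) 0 = a + ∑ i, l i := by
    rw [tailSum, show (Finset.Ici (0 : Fin (m + 1))) = Finset.univ by ext; simp,
      Fin.sum_univ_succ]
    simp
  have hs : ∀ j, tailSum (Fin.cons a l : Fin (m + 1) → ℕ) j.succ = tailSum l j := by
    intro j
    rw [tailSum, ← Fin.map_succEmb_Ici, Finset.sum_map]
    simp [tailSum]
  rw [tailExponent, Fin.sum_univ_succ, h0]
  simp [hs, tailExponent]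

theorem sum_le_tailExponent {m : ℕ} (l : Fin m → ℕ) : ∑ i, l i ≤ tailExponent l := by
  cases m with
  | zero => simp
  | succ m =>
    rw [← Fin.cons_self_tail l, tailExponent_cons, Fin.sum_univ_succ]
    simp only [Fin.cons_zero, Fin.cons_succ]
    exact (Nat.le_mul_of_pos_right _ (Nat.succ_pos _)).trans (Nat.le_add_right _ _)

theorem chainTerm_cons (β : ℕ → ℤ⟦X⟧) (m a : ℕ) (l : Fin (m + 1) → ℕ) :
    chainTerm β (m + 1) (Fin.cons a l : Fin (m + 2) → ℕ) =
      X ^ ((a + ∑ i, l i) * (a + ∑ i, l i + 1)) * (recipPoch a * chainTerm β m l) := by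
  rw [chainTerm, chainTerm, tailExponent_cons, Fin.prod_univ_succ, ← Fin.succ_last]
  simp only [Fin.castSucc_zero, Fin.cons_zero, Fin.cons_succ, ← Fin.succ_castSucc]
  ring

theorem sum_antidiagonalTuple_succ (m n : ℕ) (f : (Fin (m + 1) → ℕ) → ℤ⟦X⟧) :
    ∑ l ∈ Finset.Nat.antidiagonalTuple (m + 1) n, f l =
      ∑ p ∈ antidiagonal n, ∑ l ∈ Finset.Nat.antidiagonalTuple m p.2, f (Fin.cons p.1 l) := by
  rw [Finset.sum_sigma']
  refine Finset.sum_bij' (fun l _ => ⟨(l 0, ∑ i, Fin.tail l i), Fin.tail l⟩)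
    (fun x _ => Fin.cons x.1.1 x.2) ?_ ?_ ?_ ?_ ?_
  · intro l hl
    rw [Finset.Nat.mem_antidiagonalTuple, Fin.sum_univ_succ] at hl
    simpa [Finset.Nat.mem_antidiagonalTuple, Fin.tail] using hl
  · rintro ⟨⟨a, b⟩, l⟩ h
    simp only [Finset.mem_sigma, Finset.HasAntidiagonal.mem_antidiagonal,
      Finset.Nat.mem_antidiagonalTuple] at h
    simpa [Finset.Nat.mem_antidiagonalTuple, Fin.sum_univ_succ, h.2] using h.1
  · intro l _
    exact Fin.cons_self_tail l
  · rintro ⟨⟨a, b⟩, l⟩ h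
    simp only [Finset.mem_sigma, Finset.HasAntidiagonal.mem_antidiagonal,
      Finset.Nat.mem_antidiagonalTuple] at h
    obtain ⟨_, rfl⟩ := h
    simp
  · intro l _
    simp

/-- Fixing the total fixes $i_1=n$, hence the factor $q^{n(n+1)}$. Splitting off $l_1=n-i_2$ leaves
a shorter multisum of total $i_2$, and summing over $i_2$ is one Bailey step. -/
theorem sum_antidiagonalTuple_chainTerm (β : ℕ → ℤ⟦X⟧) (m n : ℕ) :
    ∑ l ∈ Finset.Nat.antidiagonalTuple (m + 1) n, chainTerm β m l =
      X ^ (n * (n + 1)) * (baileyStep^[m] β) n := by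
  induction m generalizing n with
  | zero => simp [chainTerm, tailExponent, tailSum]
  | succ m ih =>
    rw [sum_antidiagonalTuple_succ, Function.iterate_succ_apply', baileyStep,
      ← Finset.Nat.sum_antidiagonal_swap, Finset.mul_sum]
    refine Finset.sum_congr rfl fun p hp => ?_
    rw [Prod.fst_swap, Prod.snd_swap, ← ih, Finset.sum_mul, Finset.mul_sum]
    refine Finset.sum_congr rfl fun l hl => ?_
    rw [chainTerm_cons, Finset.Nat.mem_antidiagonalTuple.mp hl, add_comm p.2,
      Finset.HasAntidiagonal.mem_antidiagonal.mp hp, mul_comm (recipPoch _)]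

theorem summable_chainTerm (β : ℕ → ℤ⟦X⟧) (m : ℕ) : Summable (chainTerm β m) := by
  refine summable_of_X_pow_dvd (fun l => ∑ i, l i) (fun N => ?_) fun l =>
    (pow_dvd_pow X (sum_le_tailExponent l)).mul_right _
  refine (Set.finite_Iic (fun _ : Fin (m + 1) => N)).subset fun l hl i => ?_
  exact (Finset.single_le_sum (f := l) (fun _ _ => Nat.zero_le _) (Finset.mem_univ i)).trans hl

theorem X_pow_dvd_tsum_chainTerm_sub (β : ℕ → ℤ⟦X⟧) (m N : ℕ) :
    X ^ N ∣ ∑' l, chainTerm β m l -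
      ∑ n ∈ range N, X ^ (n * (n + 1)) * (baileyStep^[m] β) n := by
  simp_rw [← sum_antidiagonalTuple_chainTerm]
  rw [← Finset.sum_biUnion]
  · refine X_pow_dvd_tsum_sub_sum (summable_chainTerm β m) _ fun l hl => ?_
    simp only [Finset.mem_biUnion, Finset.mem_range, Finset.Nat.mem_antidiagonalTuple, not_exists,
      not_and] at hl
    have : N ≤ ∑ i, l i := not_lt.mp fun h => hl _ h rfl
    exact (pow_dvd_pow X (this.trans (sum_le_tailExponent l))).mul_right _
  · intro a _ b _ hab
    refine Finset.disjoint_left.mpr fun l ha hb => hab ?_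
    rw [Finset.Nat.mem_antidiagonalTuple] at ha hb
    exact ha.symm.trans hb

/-- The Bailey chain: an identity between a single series and a multisum. -/
theorem IsBaileyPair.tsum_eq {A β : ℕ → ℤ⟦X⟧} (h : IsBaileyPair A β) (m : ℕ) :
    ∑' r, X ^ ((m + 1) * (r * (r + 1))) * A r = qPochhammerInf X X * ∑' l, chainTerm β m l := by
  have hle : ∀ r : ℕ, r ≤ (m + 1) * (r * (r + 1)) := fun r =>
    by nlinarith [Nat.zero_le (m * (r * (r + 1)))]
  have hA : Summable fun r => X ^ ((m + 1) * (r * (r + 1))) * A r :=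
    summable_of_X_pow_dvd id Set.finite_Iic fun r => (pow_dvd_pow X (hle r)).mul_right _
  refine eq_of_forall_X_pow_dvd_sub fun N => ?_
  have h1 := X_pow_dvd_tsum_sub_sum hA (range N) (N := N) fun r hr =>
    (pow_dvd_pow X ((by simpa using hr : N ≤ r).trans (hle r))).mul_right _
  have h2 := (h.iterate m).X_pow_dvd N
  have h3 := (X_pow_dvd_tsum_chainTerm_sub β m N).mul_left (qPochhammerInf X X)
  have h4 : ∀ r, X ^ (r * (r + 1)) * (X ^ (m * (r * (r + 1))) * A r) =
      X ^ ((m + 1) * (r * (r + 1))) * A r := fun r => by ring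
  simp only [h4] at h2
  convert dvd_sub (dvd_sub h1 h3) h2 using 1
  ring

/-! ### Specialization to the theta and false theta series -/

theorem thetaTerm_eq_chainTerm (m : ℕ) : thetaTerm (m + 2) = chainTerm recipPoch m := by
  funext l
  rw [thetaTerm, thetaDenom, recip_prod _ _ fun j => constantCoeff_qPochhammer (l j), chainTerm]
  exact congrArg _ (Fin.prod_univ_castSucc (n := m) fun j => recip (qPochhammer X X (l j)))

theorem falseThetaTerm_eq_chainTerm (m : ℕ) (hk : 2 ≤ m + 2) :
    falseThetaTerm (m + 2) hk = chainTerm (fun n => recipPoch n ^ 2) m := by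
  funext l
  rw [falseThetaTerm, falseThetaDenom, recip_mul, recip_prod, sq, recip_mul, chainTerm, mul_comm,
    sq, mul_comm (recip _ * _)]
  · exact mul_comm _ _
  all_goals simp [constantCoeff_qPochhammer, map_prod]

theorem tsum_thetaTerm_one : ∑' l, thetaTerm 1 l = 1 := by
  have : ∀ l, thetaTerm 1 l = 1 := fun l => by
    have h : recip 1 = 1 := recip_unique (by simp) (by simp)
    simp [thetaTerm, thetaDenom, tailExponent, h]
  rw [tsum_congr this]
  exact tsum_eq_single (β := Fin 0 → ℕ) default fun l hl => (hl (Subsingleton.elim l _)).elim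

/-- Pairing index $r$ with $r+1$ produces the factor $1-q^{2r+1}$ of the seed pairs. -/
theorem tsum_sub_tsum_pnat {f g : ℕ → ℤ⟦X⟧} (hf : Summable f)
    (hg : Summable fun i : ℕ+ => g i) :
    ∑' i, f i - ∑' i : ℕ+, g i = ∑' i, (f i - g (i + 1)) := by
  rw [tsum_pnat_eq_tsum_succ, hf.tsum_sub (summable_pnat_iff_summable_succ.mp hg)]

theorem finite_pnat_le (N : ℕ) : {i : ℕ+ | (i : ℕ) ≤ N}.Finite :=
  (Set.finite_Iic N).preimage PNat.coe_injective.injOn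

theorem summable_falseTheta_left {k : ℕ} (hk : 1 ≤ k) :
    Summable (fun i : ℕ => (X : ℤ⟦X⟧) ^ (k * i ^ 2 + (k - 1) * i)) :=
  summable_of_X_pow_dvd id Set.finite_Iic fun i => pow_dvd_pow X <|
    (show i ≤ k * i ^ 2 by nlinarith [Nat.le_self_pow two_ne_zero i]).trans (Nat.le_add_right _ _)

theorem summable_falseTheta_right (k : ℕ) :
    Summable (fun i : ℕ+ => (X : ℤ⟦X⟧) ^ (k * ((i : ℕ) ^ 2 - (i : ℕ)) + (i : ℕ))) :=
  summable_of_X_pow_dvd _ finite_pnat_le fun _ => pow_dvd_pow X (Nat.le_add_left _ _)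

theorem summable_theta_left {k : ℕ} (hk : 1 ≤ k) :
    Summable (fun i : ℕ => (-1 : ℤ⟦X⟧) ^ i * X ^ (k * (i ^ 2 + i)) * X ^ (i * (i - 1) / 2)) :=
  summable_of_X_pow_dvd id Set.finite_Iic fun i =>
    ((pow_dvd_pow X (show i ≤ k * (i ^ 2 + i) by nlinarith)).mul_left _).mul_right _

theorem summable_theta_right (k : ℕ) :
    Summable (fun i : ℕ+ => (-1 : ℤ⟦X⟧) ^ (i : ℕ) * X ^ (k * ((i : ℕ) ^ 2 - (i : ℕ))) *
        X ^ ((i : ℕ) * ((i : ℕ) + 1) / 2)) :=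
  summable_of_X_pow_dvd _ finite_pnat_le fun i =>
    (pow_dvd_pow X ((Nat.le_div_iff_mul_le two_pos).mpr
      (Nat.mul_le_mul_left _ (Nat.succ_le_succ i.pos)))).mul_left _

theorem two_mul_triangle (i : ℕ) : 2 * (i * (i + 1) / 2) = i * (i + 1) :=
  Nat.mul_div_cancel' (Nat.even_mul_succ_self i).two_dvd

theorem two_mul_triangle_pred (i : ℕ) : 2 * (i * (i - 1) / 2) = i * (i - 1) :=
  Nat.mul_div_cancel' (Nat.even_mul_pred_self i).two_dvd

theorem triangle_eq_add (i : ℕ) : i * (i + 1) / 2 = i * (i - 1) / 2 + i := by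
  rw [mul_comm]
  exact Nat.triangle_succ i

theorem falseTheta_eq {k : ℕ} (hk : 1 ≤ k) :
    falseTheta (X ^ (2 * k - 1)) X =
      (∑' i : ℕ, (X : ℤ⟦X⟧) ^ (k * i ^ 2 + (k - 1) * i)) -
        ∑' i : ℕ+, (X : ℤ⟦X⟧) ^ (k * ((i : ℕ) ^ 2 - (i : ℕ)) + (i : ℕ)) := by
  obtain ⟨k, rfl⟩ := Nat.exists_eq_add_of_le' hk
  rw [falseTheta]
  congr 1 <;> refine tsum_congr fun i => ?_ <;> rw [← pow_mul, ← pow_add] <;> congr 1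
  · have h1 := two_mul_triangle i
    rw [triangle_eq_add] at h1 ⊢
    simp only [show 2 * (k + 1) - 1 = 2 * k + 1 by omega, Nat.add_sub_cancel]
    generalize i * (i - 1) / 2 = t at *
    linear_combination (k + 1) * h1
  · have h1 := two_mul_triangle_pred i
    rw [triangle_eq_add, show (i : ℕ) ^ 2 - i = i * (i - 1) by rw [sq, Nat.mul_sub_one]]
    simp only [show 2 * (k + 1) - 1 = 2 * k + 1 by omega]
    linear_combination (k + 1) * h1

theorem ramanujanTheta_eq (k : ℕ) :
    ramanujanTheta (-X ^ (2 * k)) (-X) =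
      (∑' i : ℕ, (-1 : ℤ⟦X⟧) ^ i * X ^ (k * (i ^ 2 + i)) * X ^ (i * (i - 1) / 2)) +
        ∑' i : ℕ+, (-1 : ℤ⟦X⟧) ^ (i : ℕ) * X ^ (k * ((i : ℕ) ^ 2 - (i : ℕ))) *
          X ^ ((i : ℕ) * ((i : ℕ) + 1) / 2) := by
  have hsign : ∀ t i : ℕ, (-1 : ℤ⟦X⟧) ^ (t + i) * (-1) ^ t = (-1) ^ i := fun t i => by
    rw [pow_add, mul_right_comm, ← mul_pow]
    simp
  rw [ramanujanTheta]
  congr 1 <;> refine tsum_congr fun i => ?_ <;>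
    rw [neg_pow (X ^ (2 * k)), neg_pow X, ← pow_mul, mul_mul_mul_comm]
  · have h1 := two_mul_triangle i
    rw [show k * (i ^ 2 + i) = 2 * k * (i * (i + 1) / 2) by linear_combination k * h1.symm,
      triangle_eq_add, hsign, ← mul_assoc ((-1) ^ i)]
  · have h1 := two_mul_triangle_pred i
    rw [show k * ((i : ℕ) ^ 2 - i) = 2 * k * (i * (i - 1) / 2) by
      rw [sq, ← Nat.mul_sub_one]; linear_combination k * h1.symm, triangle_eq_add,
      mul_comm ((-1) ^ _), hsign, ← mul_assoc ((-1) ^ (i : ℕ))]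

theorem tsum_falseTheta_eq (k : ℕ) (hk : 2 ≤ k) :
    (∑' i : ℕ, (X : ℤ⟦X⟧) ^ (k * i ^ 2 + (k - 1) * i)) -
        ∑' i : ℕ+, (X : ℤ⟦X⟧) ^ (k * ((i : ℕ) ^ 2 - (i : ℕ)) + (i : ℕ)) =
      qPochhammerInf X X * ∑' l : Fin (k - 1) → ℕ, falseThetaTerm k hk l := by
  rw [tsum_sub_tsum_pnat (g := fun i => X ^ (k * (i ^ 2 - i) + i))
    (summable_falseTheta_left (by omega)) (summable_falseTheta_right k)]
  obtain ⟨m, rfl⟩ := Nat.exists_eq_add_of_le' hk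
  rw [falseThetaTerm_eq_chainTerm]
  refine Eq.trans (tsum_congr fun r => ?_) (isBaileyPair_falseTheta.tsum_eq m)
  rw [show m + 2 - 1 = m + 1 by omega, show (r + 1) ^ 2 - (r + 1) = r * (r + 1) by
    rw [sq, ← Nat.mul_sub_one, Nat.add_sub_cancel, mul_comm]]
  ring

theorem tsum_theta_eq {k : ℕ} (hk : 1 ≤ k) :
    (∑' i : ℕ, (-1 : ℤ⟦X⟧) ^ i * X ^ (k * (i ^ 2 + i)) * X ^ (i * (i - 1) / 2)) +
        ∑' i : ℕ+, (-1 : ℤ⟦X⟧) ^ (i : ℕ) * X ^ (k * ((i : ℕ) ^ 2 - (i : ℕ))) *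
          X ^ ((i : ℕ) * ((i : ℕ) + 1) / 2) =
      qPochhammerInf X X * ∑' l : Fin (k - 1) → ℕ, thetaTerm k l := by
  have hsum : (∑' i : ℕ, (-1 : ℤ⟦X⟧) ^ i * X ^ (k * (i ^ 2 + i)) * X ^ (i * (i - 1) / 2)) +
        ∑' i : ℕ+, (-1 : ℤ⟦X⟧) ^ (i : ℕ) * X ^ (k * ((i : ℕ) ^ 2 - (i : ℕ))) *
          X ^ ((i : ℕ) * ((i : ℕ) + 1) / 2) =
      ∑' r : ℕ, X ^ (k * (r * (r + 1))) * unitNumerator r := by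
    rw [← sub_neg_eq_add, ← tsum_neg, tsum_sub_tsum_pnat
      (g := fun i => -((-1) ^ i * X ^ (k * (i ^ 2 - i)) * X ^ (i * (i + 1) / 2)))
      (summable_theta_left hk) (summable_theta_right k).neg]
    refine tsum_congr fun r => ?_
    rw [show (r + 1) ^ 2 - (r + 1) = r * (r + 1) by
      rw [sq, ← Nat.mul_sub_one, Nat.add_sub_cancel, mul_comm], triangle_eq_add (r + 1),
      Nat.add_sub_cancel, mul_comm (r + 1) r, triangle_eq_add r, unitNumerator,
      Nat.choose_two_right]
    ring
  rw [hsum]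
  obtain _ | _ | m := k
  · omega
  -- For $k=1$ the unit pair is used unstepped, and only the zero tuple contributes.
  · rw [tsum_thetaTerm_one]
    have h := isBaileyPair_unit.tsum_eq 0
    refine h.trans (congrArg _ ?_)
    have hone : ∀ l : Fin 1 → ℕ, l ≠ 0 →
        chainTerm (fun n => if n = 0 then 1 else 0) 0 l = 0 := fun l hl => by
      have : l 0 ≠ 0 := fun h0 => hl (by ext i; rw [Subsingleton.elim i 0]; exact h0)
      simp [chainTerm, this]
    rw [tsum_eq_single 0 hone]
    simp [chainTerm, tailExponent, tailSum]
  -- For $k=m+2$ one step goes into making $\beta_n=1/(q)_n$; the chain supplies the other $m+1$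
  -- factors $q^{r(r+1)}$.
  · rw [thetaTerm_eq_chainTerm, ← baileyStep_unit]
    refine Eq.trans (tsum_congr fun r => ?_) (isBaileyPair_unit.step.tsum_eq m)
    ring

end QSeries

open QSeries in
theorem mainTheorem1 :
    Multipliable (fun j : ℕ => 1 - (X : ℤ⟦X⟧) * X ^ j) ∧
    (∀ (k : ℕ) (hk : 2 ≤ k),
      Summable (fun i : ℕ => (X : ℤ⟦X⟧) ^ (k * i ^ 2 + (k - 1) * i)) ∧
      Summable (fun i : ℕ+ => (X : ℤ⟦X⟧) ^ (k * ((i : ℕ) ^ 2 - (i : ℕ)) + (i : ℕ))) ∧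
      Summable (fun l : Fin (k - 1) → ℕ => QSeries.falseThetaTerm k hk l) ∧
      QSeries.falseTheta (X ^ (2 * k - 1)) X =
        (∑' i : ℕ, (X : ℤ⟦X⟧) ^ (k * i ^ 2 + (k - 1) * i)) -
          ∑' i : ℕ+, (X : ℤ⟦X⟧) ^ (k * ((i : ℕ) ^ 2 - (i : ℕ)) + (i : ℕ)) ∧
      (∑' i : ℕ, (X : ℤ⟦X⟧) ^ (k * i ^ 2 + (k - 1) * i)) -
          ∑' i : ℕ+, (X : ℤ⟦X⟧) ^ (k * ((i : ℕ) ^ 2 - (i : ℕ)) + (i : ℕ)) =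
        QSeries.qPochhammerInf X X *
          ∑' l : Fin (k - 1) → ℕ, QSeries.falseThetaTerm k hk l) ∧
    (∀ (k : ℕ), 1 ≤ k →
      Summable (fun i : ℕ => (-1 : ℤ⟦X⟧) ^ i * X ^ (k * (i ^ 2 + i)) * X ^ (i * (i - 1) / 2)) ∧
      Summable (fun i : ℕ+ => (-1 : ℤ⟦X⟧) ^ (i : ℕ) * X ^ (k * ((i : ℕ) ^ 2 - (i : ℕ))) *
        X ^ ((i : ℕ) * ((i : ℕ) + 1) / 2)) ∧
      Summable (fun l : Fin (k - 1) → ℕ => QSeries.thetaTerm k l) ∧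
      QSeries.ramanujanTheta (-X ^ (2 * k)) (-X) =
        (∑' i : ℕ, (-1 : ℤ⟦X⟧) ^ i * X ^ (k * (i ^ 2 + i)) * X ^ (i * (i - 1) / 2)) +
          ∑' i : ℕ+, (-1 : ℤ⟦X⟧) ^ (i : ℕ) * X ^ (k * ((i : ℕ) ^ 2 - (i : ℕ))) *
            X ^ ((i : ℕ) * ((i : ℕ) + 1) / 2) ∧
      (∑' i : ℕ, (-1 : ℤ⟦X⟧) ^ i * X ^ (k * (i ^ 2 + i)) * X ^ (i * (i - 1) / 2)) +
          ∑' i : ℕ+, (-1 : ℤ⟦X⟧) ^ (i : ℕ) * X ^ (k * ((i : ℕ) ^ 2 - (i : ℕ))) *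
            X ^ ((i : ℕ) * ((i : ℕ) + 1) / 2) =
        QSeries.qPochhammerInf X X * ∑' l : Fin (k - 1) → ℕ, QSeries.thetaTerm k l) := by
  refine ⟨multipliable_one_sub, fun k hk => ?_, fun k hk => ?_⟩
  · have hk1 : 1 ≤ k := by omega
    refine ⟨summable_falseTheta_left hk1, summable_falseTheta_right k, ?_, falseTheta_eq hk1,
      tsum_falseTheta_eq k hk⟩
    obtain ⟨m, rfl⟩ := Nat.exists_eq_add_of_le' hk
    rw [falseThetaTerm_eq_chainTerm]
    exact summable_chainTerm _ m
  · refine ⟨summable_theta_left hk, summable_theta_right k, ?_, ramanujanTheta_eq k,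
      tsum_theta_eq hk⟩
    obtain _ | _ | m := k
    · omega
    · exact summable_of_hasFiniteSupport (Set.toFinite (α := Fin 0 → ℕ) _)
    · rw [thetaTerm_eq_chainTerm]
      exact summable_chainTerm _ m
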